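/- Let $1<r<\infty$ and $C>0$. A Banach space $\mathscr X$ is said to be $r$-LWP($C$) if $$\|x+y\|^r + C\|x-y\|^r \le 2^{r-1}\big(\|x\|^r+\|y\|^r\big)\quad\text{for all } x,y\in\mathscr X,$$ and $r$-UWP($C$) if $$\|x+y\|^r + C\|x-y\|^r \ge 2^{r-1}\big(\|x\|^r+\|y\|^r\big)\quad\text{for all } x,y\in\mathscr X.$$ Let $$C_{p,r} := \inf_{0\le t<1}\frac{2^{r-r/p}(1+t^p)^{r/p}-(1+t)^r}{(1-t)^r}.$$ Theorem (Optimal Constants Theorem). Let $(X,\Omega,\sigma)$ be a measure space, let $1<p<\infty$, $1/p+1/q=1$, and let $L^p=L^p(X,\Omega,\sigma)$ be the space of real-valued or of complex-valued functions. If $1<p\le 2$, then $L^p$ is - $r$-UWP($1$) when $1<r\le p$; - $r$-LWP($C_{p,r}$) when $2\le r\le q$; and - $r$-LWP($1$) when $q\le r<\infty$. If $2\le p<\infty$, then $L^p$ is - $r$-LWP($1$) when $p\le r<\infty$; - $r$-UWP($C_{q,r'}^{-r/r'}$) when $q\le r\le 2$, where $1/r+1/r'=1$; and - $r$-UWP($1$)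 when $1<r\le q$. These constants are optimal, that is, largest possible in the LWP statements and smallest possible in the UWP statements. For the constants equal to $1$ by assertion this holds as soon as there is a measurable set of positive finite measure; for $C_{p,r}$ and $C_{q,r'}^{-r/r'}$ it holds as soon as there are two disjoint measurable sets of positive finite measure. -/

import Mathlib

open MeasureTheory
open scoped ENNReal

/-- `X` satisfies the `r`-lower weak parallelogram law with constant `C`. -/
def IsLWP (X : Type*) [NormedAddCommGroup X] (r C : ℝ) : Prop :=
  1 < r ∧ 0 < C ∧
    ∀ x y : X, ‖x + y‖ ^ r + C * ‖x - y‖ ^ r ≤ 2 ^ (r - 1) * (‖x‖ ^ r + ‖y‖ ^ r)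

/-- `X` satisfies the `r`-upper weak parallelogram law with constant `C`. -/
def IsUWP (X : Type*) [NormedAddCommGroup X] (r C : ℝ) : Prop :=
  1 < r ∧ 0 < C ∧
    ∀ x y : X, 2 ^ (r - 1) * (‖x‖ ^ r + ‖y‖ ^ r) ≤ ‖x + y‖ ^ r + C * ‖x - y‖ ^ r

/-- `C` is the largest constant for which `X` satisfies the `r`-lower law. -/
def IsOptimalLWP (X : Type*) [NormedAddCommGroup X] (r C : ℝ) : Prop :=
  IsGreatest {C' : ℝ | IsLWP X r C'} C

/-- `C` is the smallest constant for which `X` satisfies the `r`-upper law. -/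
def IsOptimalUWP (X : Type*) [NormedAddCommGroup X] (r C : ℝ) : Prop :=
  IsLeast {C' : ℝ | IsUWP X r C'} C

/-- The weak parallelogram constant `C_{p,r}`, an infimum over `0 ≤ t < 1`. -/
noncomputable def wpConst (p r : ℝ) : ℝ :=
  sInf ((fun t : ℝ =>
    (2 ^ (r - r / p) * (1 + t ^ p) ^ (r / p) - (1 + t) ^ r) / (1 - t) ^ r) '' Set.Ico (0 : ℝ) 1)

/-- There is a measurable set of positive finite measure; for `1 < p < ∞` this says that the space
`L^p(μ)` is nonzero. -/
def HasPosFiniteSet {Ω : Type*} [MeasurableSpace Ω] (μ : Measure Ω) : Prop :=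
  ∃ A : Set Ω, MeasurableSet A ∧ μ A ≠ 0 ∧ μ A ≠ ∞

/-- There are two disjoint measurable sets of positive finite measure; for `1 < p < ∞` this says
that the space `L^p(μ)` has dimension at least two. -/
def HasTwoPosFiniteSets {Ω : Type*} [MeasurableSpace Ω] (μ : Measure Ω) : Prop :=
  ∃ A B : Set Ω, MeasurableSet A ∧ MeasurableSet B ∧ Disjoint A B ∧
    μ A ≠ 0 ∧ μ A ≠ ∞ ∧ μ B ≠ 0 ∧ μ B ≠ ∞

/-!
The substitution `u = f + g`, `v = f - g` turns a weak parallelogram law into a comparison of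
`‖u + v‖`, `‖u - v‖` with `‖u‖`, `‖v‖`, and Hanner's inequality
`‖u + v‖ ^ p + ‖u - v‖ ^ p ≥ (‖u‖ + ‖v‖) ^ p + |‖u‖ - ‖v‖| ^ p` for `p ≤ 2` (reversed for `p ≥ 2`)
reduces this to an inequality between the two real numbers `‖u‖`, `‖v‖`, which is the same law for
the vectors `(x, y)`, `(y, x)` of the `ℓ^p` plane (`IsHanner.isLWP`, `IsHanner.isUWP`).

Hanner's inequality in `L^p` (`Lp_isHanner`) comes from the tangent line inequality
`(a + b) ^ p + |a - b| ^ p ≥ α(s) a ^ p + β(s) b ^ p` (`hanner_tangent`), which is linear in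
`a ^ p`, `b ^ p`, so it can be integrated, and is an equality for `b = s a`. The choice `s = t ^ q`
in the same inequality gives Clarkson's inequality (`clarkson_two_point`).

In the plane, the lower law with `p ≤ 2 ≤ r ≤ q` is exactly the definition of `C_{p,r}` as an
infimum (`twoPointLower_wpConst`); this infimum is positive because
`(1 + R) ^ p + (1 - R) ^ p ≥ 2 + p (p - 1) R ^ 2`. For `r = q` Clarkson's inequality allows the
constant `1`. The upper law with `q ≤ r ≤ 2 ≤ p` is dual to the lower one with the conjugate
exponents, by Hölder's inequality in the plane (`TwoPointLower.upper`, `TwoPointUpper.lower`). The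
remaining laws with constant `1` follow from the scalar inequalities
`clarkson_norm_of_two_le`, `clarkson_norm_of_le_two`, and from the fact that the laws with constant
`1` improve in one direction of `r` (`IsLWP.mono_one`, `IsUWP.mono_one`).

The constant `1` is optimal in every nonzero space because of the pair `v`, `-v`. Two disjoint sets
of positive finite measure give an isometric copy of the real `ℓ^p` plane in `L^p`, so that a law in
`L^p` implies the law in the plane, whose best constant is known from the definition of `C_{p,r}`
and from the duality.
-/

/-! ### The tangent line inequality -/

/-- The coefficient `α` of `a ^ p` in the tangent line inequality `hanner_tangent` for
`(a + b) ^ p + |a - b| ^ p`. -/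
noncomputable def hannerA (p s : ℝ) : ℝ := (1 + s) ^ (p - 1) + (1 - s) ^ (p - 1)

/-- The coefficient `β` of `b ^ p` in the tangent line inequality `hanner_tangent`. For `s > 0`; at
`s = 0` the factor `s ^ (1 - p)` has a junk value, and `hannerB` is only used on `0 < s ≤ 1`. -/
noncomputable def hannerB (p s : ℝ) : ℝ :=
  ((1 + s) ^ (p - 1) - (1 - s) ^ (p - 1)) * s ^ (1 - p)

/-- The derivatives of `α` and `β` satisfy `β' = -s ^ (-p) α'`, so that `α + c β` is critical at
`s ^ p = c`. -/
theorem hasDerivAt_hanner (p c : ℝ) {s : ℝ} (h0 : 0 < s) (h1 : s < 1) :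
    HasDerivAt (fun s => hannerA p s + hannerB p s * c)
      ((p - 1) * ((1 + s) ^ (p - 2) - (1 - s) ^ (p - 2)) * (1 - c * s ^ (-p))) s := by
  have hp : HasDerivAt (fun s : ℝ => (1 + s) ^ (p - 1)) ((p - 1) * (1 + s) ^ (p - 2)) s := by
    have := ((hasDerivAt_id' s).const_add 1).rpow_const (p := p - 1) (Or.inl (by linarith))
    refine this.congr_deriv ?_
    rw [show p - 1 - 1 = p - 2 by ring]
    ring
  have hm : HasDerivAt (fun s : ℝ => (1 - s) ^ (p - 1)) (-((p - 1) * (1 - s) ^ (p - 2))) s := by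
    have := ((hasDerivAt_id' s).const_sub 1).rpow_const (p := p - 1) (Or.inl (by linarith))
    refine this.congr_deriv ?_
    rw [show p - 1 - 1 = p - 2 by ring]
    ring
  have hs : HasDerivAt (fun s : ℝ => s ^ (1 - p)) ((1 - p) * s ^ (-p)) s := by
    have := Real.hasDerivAt_rpow_const (x := s) (p := 1 - p) (Or.inl h0.ne')
    convert this using 3
    ring
  have h := (hp.add hm).add (((hp.sub hm).mul hs).mul_const c)
  refine h.congr_deriv ?_
  have e1 : (1 + s) ^ (p - 1) = (1 + s) ^ (p - 2) * (1 + s) := by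
    rw [← Real.rpow_add_one (by linarith)]; ring_nf
  have e2 : (1 - s) ^ (p - 1) = (1 - s) ^ (p - 2) * (1 - s) := by
    rw [← Real.rpow_add_one (by linarith)]; ring_nf
  have e3 : s ^ (1 - p) = s ^ (-p) * s := by
    rw [← Real.rpow_add_one h0.ne']; ring_nf
  simp only [Pi.sub_apply]
  rw [e1, e2, e3]
  ring

theorem continuousOn_hannerA {p : ℝ} (hp : 1 < p) : ContinuousOn (hannerA p) (Set.Icc 0 1) := by
  have : Continuous (hannerA p) := by
    unfold hannerA
    exact ((continuous_const.add continuous_id).rpow_const fun _ => Or.inr (by linarith)).add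
      ((continuous_const.sub continuous_id).rpow_const fun _ => Or.inr (by linarith))
  exact this.continuousOn

theorem continuousOn_hannerB {p : ℝ} (hp : 1 < p) : ContinuousOn (hannerB p) (Set.Ioc 0 1) := by
  unfold hannerB
  have : Continuous (fun s : ℝ => (1 + s) ^ (p - 1) - (1 - s) ^ (p - 1)) :=
    ((continuous_const.add continuous_id).rpow_const fun _ => Or.inr (by linarith)).sub
      ((continuous_const.sub continuous_id).rpow_const fun _ => Or.inr (by linarith))
  exact this.continuousOn.mul (continuousOn_id.rpow_const fun x hx => Or.inl hx.1.ne')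

theorem hannerA_add_hannerB_self {p s : ℝ} (hp : 1 < p) (h0 : 0 < s) (h1 : s ≤ 1) :
    hannerA p s + hannerB p s * s ^ p = (1 + s) ^ p + (1 - s) ^ p := by
  have e1 : (1 + s) ^ p = (1 + s) ^ (p - 1) * (1 + s) := by
    rw [← Real.rpow_add_one (by linarith)]; ring_nf
  have e2 : (1 - s) ^ p = (1 - s) ^ (p - 1) * (1 - s) := by
    rw [← Real.rpow_add_one' (by linarith) (by linarith)]; ring_nf
  have e3 : s ^ (1 - p) * s ^ p = s := by
    rw [← Real.rpow_add h0]; simp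
  rw [hannerA, hannerB, mul_assoc, e3, e1, e2]
  ring

/-- The exponent `p` and the sign `ε` match: `ε = 1` for `p ≥ 2` and `ε = -1` for `p ≤ 2`.
Hanner's inequality reverses at `p = 2`; multiplying both sides by `ε` lets one proof serve both
ranges. -/
def HannerSign (p ε : ℝ) : Prop :=
  (ε = 1 ∧ 2 ≤ p) ∨ (ε = -1 ∧ p ≤ 2)

theorem HannerSign.rpow_diff {p ε : ℝ} (h : HannerSign p ε) {s : ℝ} (h0 : 0 < s) (h1 : s < 1) :
    0 ≤ ε * ((1 + s) ^ (p - 2) - (1 - s) ^ (p - 2)) := by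
  rcases h with ⟨rfl, hp⟩ | ⟨rfl, hp⟩
  · have := Real.rpow_le_rpow (x := 1 - s) (y := 1 + s) (z := p - 2) (by linarith) (by linarith)
      (by linarith)
    linarith
  · have := Real.rpow_le_rpow_of_nonpos (x := 1 - s) (y := 1 + s) (z := p - 2) (by linarith)
      (by linarith) (by linarith)
    linarith

/-- For fixed `R ≤ 1` the function `s ↦ ε (α(s) + β(s) R ^ p)` is minimal at `s = R`. -/
theorem hanner_self_le {p ε : ℝ} (hp : 1 < p) (hε : HannerSign p ε) {R s : ℝ} (hR0 : 0 < R)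
    (hR1 : R ≤ 1) (hs0 : 0 < s) (hs1 : s ≤ 1) :
    ε * (hannerA p R + hannerB p R * R ^ p) ≤ ε * (hannerA p s + hannerB p s * R ^ p) := by
  have hc : ContinuousOn (fun s => ε * (hannerA p s + hannerB p s * R ^ p)) (Set.Ioc 0 1) :=
    continuousOn_const.mul (((continuousOn_hannerA hp).mono Set.Ioc_subset_Icc_self).add
      ((continuousOn_hannerB hp).mul continuousOn_const))
  have hd : ∀ x, 0 < x → x < 1 → HasDerivAt (fun s => ε * (hannerA p s + hannerB p s * R ^ p)) _ x :=
    fun x h0 h1 => (hasDerivAt_hanner p (R ^ p) h0 h1).const_mul ε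
  have key : ∀ x : ℝ, 0 < x → x ^ (-p) * x ^ p = 1 := fun x hx => by
    rw [← Real.rpow_add hx]; simp
  rcases le_total s R with h | h
  · refine antitoneOn_of_deriv_nonpos (convex_Icc s R)
      (hc.mono fun x hx => ⟨hs0.trans_le hx.1, hx.2.trans hR1⟩) ?_ ?_
      (Set.left_mem_Icc.2 h) (Set.right_mem_Icc.2 h) h
    · intro x hx
      rw [interior_Icc] at hx
      exact (hd x (hs0.trans hx.1) (hx.2.trans_le hR1)).differentiableAt.differentiableWithinAt
    · intro x hx
      rw [interior_Icc] at hx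
      have hx0 := hs0.trans hx.1
      have hx1 := hx.2.trans_le hR1
      rw [(hd x hx0 hx1).deriv]
      have h1 := hε.rpow_diff hx0 hx1
      have h2 : 1 ≤ R ^ p * x ^ (-p) := by
        rw [← key x hx0, mul_comm]
        exact mul_le_mul_of_nonneg_right (Real.rpow_le_rpow hx0.le hx.2.le (by linarith))
          (Real.rpow_nonneg hx0.le _)
      have := mul_nonneg (mul_nonneg (sub_nonneg.2 hp.le) h1) (sub_nonneg.2 h2)
      linarith
  · refine monotoneOn_of_deriv_nonneg (convex_Icc R s)
      (hc.mono fun x hx => ⟨hR0.trans_le hx.1, hx.2.trans hs1⟩) ?_ ?_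
      (Set.left_mem_Icc.2 h) (Set.right_mem_Icc.2 h) h
    · intro x hx
      rw [interior_Icc] at hx
      exact (hd x (hR0.trans hx.1) (hx.2.trans_le hs1)).differentiableAt.differentiableWithinAt
    · intro x hx
      rw [interior_Icc] at hx
      have hx0 := hR0.trans hx.1
      have hx1 := hx.2.trans_le hs1
      rw [(hd x hx0 hx1).deriv]
      have h1 := hε.rpow_diff hx0 hx1
      have h2 : R ^ p * x ^ (-p) ≤ 1 := by
        rw [← key x hx0, mul_comm]
        exact mul_le_mul_of_nonneg_left (Real.rpow_le_rpow hR0.le hx.1.le (by linarith))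
          (Real.rpow_nonneg hx0.le _)
      have := mul_nonneg (mul_nonneg (sub_nonneg.2 hp.le) h1) (sub_nonneg.2 h2)
      linarith

/-- `ε (α - β)` is increasing on `(0, 1]` and vanishes at `1`. -/
theorem hannerA_le_hannerB {p ε : ℝ} (hp : 1 < p) (hε : HannerSign p ε) {s : ℝ}
    (hs0 : 0 < s) (hs1 : s ≤ 1) : ε * hannerA p s ≤ ε * hannerB p s := by
  have hm : MonotoneOn (fun s => ε * (hannerA p s + hannerB p s * (-1))) (Set.Icc s 1) := by
    refine monotoneOn_of_deriv_nonneg (convex_Icc s 1) ?_ ?_ ?_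
    · refine ContinuousOn.mono (s := Set.Ioc 0 1) ?_ fun x hx => ⟨hs0.trans_le hx.1, hx.2⟩
      exact continuousOn_const.mul (((continuousOn_hannerA hp).mono Set.Ioc_subset_Icc_self).add
        ((continuousOn_hannerB hp).mul continuousOn_const))
    · intro x hx
      rw [interior_Icc] at hx
      exact ((hasDerivAt_hanner p (-1) (hs0.trans hx.1) hx.2).const_mul
        ε).differentiableAt.differentiableWithinAt
    · intro x hx
      rw [interior_Icc] at hx
      have hx0 := hs0.trans hx.1
      rw [((hasDerivAt_hanner p (-1) hx0 hx.2).const_mul ε).deriv]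
      have h1 := hε.rpow_diff hx0 hx.2
      have h2 := Real.rpow_nonneg hx0.le (-p)
      have := mul_nonneg (mul_nonneg (sub_nonneg.2 hp.le) h1) (by linarith : 0 ≤ 1 + x ^ (-p))
      linarith
  have h := hm (Set.left_mem_Icc.2 hs1) (Set.right_mem_Icc.2 hs1) hs1
  have h1 : hannerA p 1 = hannerB p 1 := by
    simp [hannerA, hannerB, Real.zero_rpow (by linarith : p - 1 ≠ 0)]
  simp only [h1] at h
  linarith

theorem two_le_hannerA {p ε : ℝ} (hp : 1 < p) (hε : HannerSign p ε) {s : ℝ}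
    (hs0 : 0 < s) (hs1 : s ≤ 1) : ε * 2 ≤ ε * hannerA p s := by
  have hm : MonotoneOn (fun s => ε * hannerA p s) (Set.Icc 0 1) := by
    have hd : ∀ x, 0 < x → x < 1 → HasDerivAt (fun s => ε * hannerA p s)
        (ε * ((p - 1) * ((1 + x) ^ (p - 2) - (1 - x) ^ (p - 2)))) x := fun x h0 h1 => by
      simpa using (hasDerivAt_hanner p 0 h0 h1).const_mul ε
    refine monotoneOn_of_deriv_nonneg (convex_Icc 0 1)
      (continuousOn_const.mul (continuousOn_hannerA hp)) ?_ ?_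
    · intro x hx
      rw [interior_Icc] at hx
      exact (hd x hx.1 hx.2).differentiableAt.differentiableWithinAt
    · intro x hx
      rw [interior_Icc] at hx
      rw [(hd x hx.1 hx.2).deriv]
      have := mul_nonneg (sub_nonneg.2 hp.le) (hε.rpow_diff hx.1 hx.2)
      linarith
  have h := hm (Set.left_mem_Icc.2 zero_le_one) ⟨hs0.le, hs1⟩ hs0.le
  have h0 : hannerA p 0 = 2 := by norm_num [hannerA]
  simpa only [h0] using h

theorem hanner_tangent_of_le {p ε : ℝ} (hp : 1 < p) (hε : HannerSign p ε) {s : ℝ}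
    (hs0 : 0 < s) (hs1 : s ≤ 1) {a b : ℝ} (hb : 0 ≤ b) (hab : b ≤ a) :
    ε * ((a + b) ^ p + (a - b) ^ p) ≤ ε * (hannerA p s * a ^ p + hannerB p s * b ^ p) := by
  rcases hb.eq_or_lt with rfl | hb
  · have h := mul_le_mul_of_nonneg_right (two_le_hannerA hp hε hs0 hs1) (Real.rpow_nonneg hab p)
    simp only [add_zero, sub_zero, Real.zero_rpow (by linarith : p ≠ 0)]
    linarith
  · have ha : 0 < a := hb.trans_le hab
    have hR : b / a ≤ 1 := (div_le_one ha).2 hab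
    have h := mul_le_mul_of_nonneg_right
      (hanner_self_le hp hε (div_pos hb ha) hR hs0 hs1) (Real.rpow_nonneg ha.le p)
    rw [hannerA_add_hannerB_self hp (div_pos hb ha) hR] at h
    have e1 : (a + b) ^ p = (1 + b / a) ^ p * a ^ p := by
      rw [← Real.mul_rpow (by positivity) ha.le]; congr 1; field_simp
    have e2 : (a - b) ^ p = (1 - b / a) ^ p * a ^ p := by
      rw [← Real.mul_rpow (by linarith) ha.le]; congr 1; field_simp
    have e3 : b ^ p = (b / a) ^ p * a ^ p := by
      rw [← Real.mul_rpow (by positivity) ha.le]; congr 1; field_simp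
    rw [e1, e2, e3]
    linarith

/-- The tangent line inequality behind Hanner's inequality: for `p ≥ 2` (reversed for `p ≤ 2`) the
left side is at most `α(s) a ^ p + β(s) b ^ p`, with equality for `b = s a`. The right side is linear
in `(a ^ p, b ^ p)` and can therefore be integrated. -/
theorem hanner_tangent {p ε : ℝ} (hp : 1 < p) (hε : HannerSign p ε) {s : ℝ}
    (hs0 : 0 < s) (hs1 : s ≤ 1) {a b : ℝ} (ha : 0 ≤ a) (hb : 0 ≤ b) :
    ε * ((a + b) ^ p + |a - b| ^ p) ≤ ε * (hannerA p s * a ^ p + hannerB p s * b ^ p) := by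
  rcases le_total b a with h | h
  · rw [abs_of_nonneg (sub_nonneg.2 h)]
    exact hanner_tangent_of_le hp hε hs0 hs1 hb h
  · rw [abs_sub_comm, abs_of_nonneg (sub_nonneg.2 h), add_comm a b]
    -- exchanging `a ≤ b` on the right side only helps, because `ε (α - β) ≤ 0`
    refine (hanner_tangent_of_le hp hε hs0 hs1 ha h).trans ?_
    have h1 := hannerA_le_hannerB hp hε hs0 hs1
    have h2 := Real.rpow_le_rpow ha h (by linarith : 0 ≤ p)
    have := mul_nonneg (sub_nonneg.2 h1) (sub_nonneg.2 h2)
    linarith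

/-- Clarkson's two-point inequality. It is the tangent line inequality at `(1, t)` with the slope
parameter `s = t ^ q`, for which `α(s) + β(s) t ^ p` collapses to the right side. -/
theorem clarkson_two_point {p q : ℝ} (hpq : p.HolderConjugate q) (hp : 2 ≤ p) {t : ℝ}
    (h0 : 0 ≤ t) (h1 : t ≤ 1) :
    (1 + t) ^ p + (1 - t) ^ p ≤ 2 * (1 + t ^ q) ^ (p - 1) := by
  rcases h0.eq_or_lt with rfl | h0
  · simp [Real.zero_rpow hpq.symm.ne_zero]; norm_num
  have h := hanner_tangent hpq.lt (Or.inl ⟨rfl, hp⟩) (Real.rpow_pos_of_pos h0 q)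
    (Real.rpow_le_one h0.le h1 hpq.symm.nonneg) zero_le_one h0.le
  rw [abs_of_nonneg (sub_nonneg.2 h1), hannerA, hannerB, mul_assoc, ← Real.rpow_mul h0.le,
    ← Real.rpow_add h0] at h
  have e : q * (1 - p) + p = 0 := by linarith [hpq.mul_eq_add]
  rw [e, Real.rpow_zero, Real.one_rpow] at h
  linarith

/-! ### Pointwise inequalities for scalars -/

theorem rpow_add_rpow_le_rpow_div {p r a b : ℝ} (hp : 0 < p) (hpr : p ≤ r) (ha : 0 ≤ a)
    (hb : 0 ≤ b) : a ^ r + b ^ r ≤ (a ^ p + b ^ p) ^ (r / p) := by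
  have h := NNReal.add_rpow_le_rpow_add (⟨a ^ p, Real.rpow_nonneg ha p⟩ : NNReal)
    ⟨b ^ p, Real.rpow_nonneg hb p⟩ ((one_le_div hp).2 hpr)
  rw [← NNReal.coe_le_coe] at h
  change (a ^ p) ^ (r / p) + (b ^ p) ^ (r / p) ≤ (a ^ p + b ^ p) ^ (r / p) at h
  rwa [← Real.rpow_mul ha, ← Real.rpow_mul hb, mul_div_cancel₀ r hp.ne'] at h

theorem rpow_div_le_mul_rpow_add_rpow {p r a b : ℝ} (hp : 0 < p) (hpr : p ≤ r) (ha : 0 ≤ a)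
    (hb : 0 ≤ b) : (a ^ p + b ^ p) ^ (r / p) ≤ 2 ^ (r / p - 1) * (a ^ r + b ^ r) := by
  have h := NNReal.rpow_add_le_mul_rpow_add_rpow (⟨a ^ p, Real.rpow_nonneg ha p⟩ : NNReal)
    ⟨b ^ p, Real.rpow_nonneg hb p⟩ ((one_le_div hp).2 hpr)
  rw [← NNReal.coe_le_coe] at h
  change (a ^ p + b ^ p) ^ (r / p) ≤
    2 ^ (r / p - 1) * ((a ^ p) ^ (r / p) + (b ^ p) ^ (r / p)) at h
  rwa [← Real.rpow_mul ha, ← Real.rpow_mul hb, mul_div_cancel₀ r hp.ne'] at h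

/-- Two points symmetric about the midpoint of `[m, M]` give a smaller sum of values of a convex
function than the end points do. -/
theorem ConvexOn.add_le_add_of_abs_sub_le {φ : ℝ → ℝ} (hφ : ConvexOn ℝ (Set.Ici 0) φ)
    {m M x y : ℝ} (hm : 0 ≤ m) (hmM : m ≤ M) (hsum : x + y = M + m) (hxy : |x - y| ≤ M - m) :
    φ x + φ y ≤ φ M + φ m := by
  obtain ⟨h1, h2⟩ := abs_le.1 hxy
  rcases hmM.eq_or_lt with rfl | hlt
  · obtain rfl : x = m := by linarith
    obtain rfl : y = x := by linarith
    exact le_rfl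
  · have hd : 0 < M - m := sub_pos.2 hlt
    have hl0 : 0 ≤ (x - m) / (M - m) := div_nonneg (by linarith) hd.le
    have hl1 : 0 ≤ (M - x) / (M - m) := div_nonneg (by linarith) hd.le
    have hl : (x - m) / (M - m) + (M - x) / (M - m) = 1 := by field_simp; ring
    have hx := hφ.2 (Set.mem_Ici.2 (hm.trans hmM)) (Set.mem_Ici.2 hm) hl0 hl1 hl
    have hy := hφ.2 (Set.mem_Ici.2 hm) (Set.mem_Ici.2 (hm.trans hmM)) hl0 hl1 hl
    have ex : (x - m) / (M - m) * M + (M - x) / (M - m) * m = x := by field_simp; ring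
    have ey : (x - m) / (M - m) * m + (M - x) / (M - m) * M = y := by
      have : y = M + m - x := by linarith
      rw [this]; field_simp; ring
    simp only [smul_eq_mul, ex, ey] at hx hy
    linear_combination hx + hy + (φ M + φ m) * hl

theorem HannerSign.convexOn {p ε : ℝ} (hp : 0 ≤ p) (h : HannerSign p ε) :
    ConvexOn ℝ (Set.Ici 0) fun x : ℝ => ε * x ^ (p / 2) := by
  rcases h with ⟨rfl, h2⟩ | ⟨rfl, h2⟩
  · simpa using convexOn_rpow (p := p / 2) (by linarith)
  · simp only [neg_one_mul]
    exact (Real.concaveOn_rpow (p := p / 2) (by linarith) (by linarith)).neg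

theorem rpow_eq_sq_rpow_half {x : ℝ} (hx : 0 ≤ x) (p : ℝ) : x ^ p = (x ^ 2) ^ (p / 2) := by
  rw [← Real.rpow_natCast, ← Real.rpow_mul hx]
  congr 1
  push_cast
  ring

/-- Scalars reduce to the moduli: `‖a + b‖ ^ 2` and `‖a - b‖ ^ 2` have the same sum as
`(‖a‖ + ‖b‖) ^ 2` and `(‖a‖ - ‖b‖) ^ 2` and lie between them, and `ε x ^ (p / 2)` is convex. -/
theorem hanner_norm {𝕜 : Type*} [RCLike 𝕜] {p ε : ℝ} (hp : 0 ≤ p) (h : HannerSign p ε) (a b : 𝕜) :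
    ε * (‖a + b‖ ^ p + ‖a - b‖ ^ p) ≤
      ε * ((‖a‖ + ‖b‖) ^ p + |‖a‖ - ‖b‖| ^ p) := by
  have hpar := parallelogram_law_with_norm ℝ a b
  have h1 := norm_add_le a b
  have h2 := norm_sub_le a b
  have n1 := norm_nonneg (a + b)
  have n2 := norm_nonneg (a - b)
  have na := norm_nonneg a
  have nb := norm_nonneg b
  rw [rpow_eq_sq_rpow_half n1, rpow_eq_sq_rpow_half n2, rpow_eq_sq_rpow_half (add_nonneg na nb),
    rpow_eq_sq_rpow_half (abs_nonneg _), sq_abs, mul_add, mul_add]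
  refine (h.convexOn hp).add_le_add_of_abs_sub_le (sq_nonneg _) ?_ ?_ ?_
  · nlinarith [mul_nonneg na nb]
  · linarith
  · rw [abs_le]; constructor <;> nlinarith

theorem clarkson_norm_of_two_le {𝕜 : Type*} [RCLike 𝕜] {p : ℝ} (hp : 2 ≤ p) (a b : 𝕜) :
    2 * (‖a‖ ^ p + ‖b‖ ^ p) ≤ ‖a + b‖ ^ p + ‖a - b‖ ^ p := by
  have hpar := parallelogram_law_with_norm ℝ a b
  have h1 := rpow_add_rpow_le_rpow_div two_pos hp (norm_nonneg a) (norm_nonneg b)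
  have h2 := rpow_div_le_mul_rpow_add_rpow two_pos hp (norm_nonneg (a + b)) (norm_nonneg (a - b))
  simp only [Real.rpow_two] at h1 h2
  have e : ‖a + b‖ ^ 2 + ‖a - b‖ ^ 2 = 2 * (‖a‖ ^ 2 + ‖b‖ ^ 2) := by linarith
  rw [e, Real.mul_rpow two_pos.le (by positivity), Real.rpow_sub two_pos, Real.rpow_one,
    div_mul_eq_mul_div, mul_div_assoc] at h2
  have := le_of_mul_le_mul_left h2 (by positivity)
  linarith

theorem clarkson_norm_of_le_two {𝕜 : Type*} [RCLike 𝕜] {p : ℝ} (h0 : 0 < p) (hp : p ≤ 2) (a b : 𝕜) :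
    ‖a + b‖ ^ p + ‖a - b‖ ^ p ≤ 2 * (‖a‖ ^ p + ‖b‖ ^ p) := by
  have hpar := parallelogram_law_with_norm ℝ a b
  have na := norm_nonneg a
  have nb := norm_nonneg b
  have key : ∀ x : ℝ, 0 ≤ x → (x ^ (2 / p)) ^ (p / 2) = x := fun x hx => by
    rw [← Real.rpow_mul hx]; field_simp; simp
  have h1 := rpow_add_rpow_le_rpow_div h0 hp na nb
  have h2 := rpow_div_le_mul_rpow_add_rpow h0 hp (norm_nonneg (a + b)) (norm_nonneg (a - b))
  simp only [Real.rpow_two] at h1 h2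
  have e : ‖a + b‖ ^ 2 + ‖a - b‖ ^ 2 = 2 * (‖a‖ ^ 2 + ‖b‖ ^ 2) := by linarith
  rw [e, ← mul_assoc, ← Real.rpow_add_one two_ne_zero, sub_add_cancel] at h2
  have h3 := h2.trans (mul_le_mul_of_nonneg_left h1 (by positivity))
  rw [← Real.mul_rpow two_pos.le (by positivity)] at h3
  exact (Real.rpow_le_rpow_iff (by positivity) (by positivity) (by positivity)).1 h3

/-! ### The laws in the `ℓ^p` plane and their duality -/

/-- The `r`-lower weak parallelogram law with constant `C` in the real plane with the `ℓ^p` norm,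
for the vectors `(x, y)` and `(y, x)`. -/
def TwoPointLower (p r C : ℝ) : Prop :=
  ∀ x y : ℝ, |x + y| ^ r + C * |x - y| ^ r ≤ 2 ^ (r - r / p) * (|x| ^ p + |y| ^ p) ^ (r / p)

/-- The `r`-upper weak parallelogram law with constant `D` in the real plane with the `ℓ^p` norm,
for the vectors `(x, y)` and `(y, x)`. -/
def TwoPointUpper (p r D : ℝ) : Prop :=
  ∀ x y : ℝ, 2 ^ (r - r / p) * (|x| ^ p + |y| ^ p) ^ (r / p) ≤ |x + y| ^ r + D * |x - y| ^ r

/-- By homogeneity and symmetry only `(x, y) = (1, t)` matters; for `x` and `y` of opposite signs the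
roles of `x + y` and `x - y` are exchanged, which `C ≤ 1` makes harmless. -/
theorem twoPointLower_of_Ico {p r C : ℝ} (hp : 0 < p) (hr : 0 < r) (hC : C ≤ 1)
    (h : ∀ t ∈ Set.Ico (0 : ℝ) 1,
      (1 + t) ^ r + C * (1 - t) ^ r ≤ 2 ^ (r - r / p) * (1 + t ^ p) ^ (r / p)) :
    TwoPointLower p r C := by
  -- the bound for `x ≥ y ≥ 0`
  have h1 : ∀ x y : ℝ, 0 ≤ y → y ≤ x →
      (x + y) ^ r + C * (x - y) ^ r ≤ 2 ^ (r - r / p) * (x ^ p + y ^ p) ^ (r / p) := by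
    intro x y hy hyx
    rcases hyx.eq_or_lt with rfl | hlt
    · rw [sub_self, Real.zero_rpow hr.ne', mul_zero, add_zero, ← two_mul, ← two_mul,
        Real.mul_rpow two_pos.le hy, Real.mul_rpow two_pos.le (by positivity), ← mul_assoc,
        ← Real.rpow_add two_pos, ← Real.rpow_mul hy, sub_add_cancel, mul_div_cancel₀ r hp.ne']
    · have hx : 0 < x := hy.trans_lt hlt
      have ht := h (y / x) ⟨by positivity, (div_lt_one hx).2 hlt⟩
      have hle : y / x ≤ 1 := (div_le_one hx).2 hyx
      have ht := mul_le_mul_of_nonneg_right ht (Real.rpow_nonneg hx.le r)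
      have e1 : (x + y) ^ r = (1 + y / x) ^ r * x ^ r := by
        rw [← Real.mul_rpow (by positivity) hx.le]; congr 1; field_simp
      have e2 : (x - y) ^ r = (1 - y / x) ^ r * x ^ r := by
        rw [← Real.mul_rpow (by linarith) hx.le]; congr 1; field_simp
      have e3 : (x ^ p + y ^ p) ^ (r / p) = (1 + (y / x) ^ p) ^ (r / p) * x ^ r := by
        have : x ^ r = (x ^ p) ^ (r / p) := by
          rw [← Real.rpow_mul hx.le, mul_div_cancel₀ r hp.ne']
        rw [this, ← Real.mul_rpow (by positivity) (by positivity), Real.div_rpow hy hx.le]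
        congr 1
        field_simp
      rw [e1, e2, e3]
      linarith
  have h2 : ∀ x y : ℝ, |y| ≤ |x| →
      |x + y| ^ r + C * |x - y| ^ r ≤ 2 ^ (r - r / p) * (|x| ^ p + |y| ^ p) ^ (r / p) := by
    intro x y hyx
    have h := h1 |x| |y| (abs_nonneg y) hyx
    have hmono := Real.rpow_le_rpow (sub_nonneg.2 hyx)
      (by linarith [abs_nonneg y] : |x| - |y| ≤ |x| + |y|) hr.le
    have hC' := mul_nonneg (sub_nonneg.2 hC) (sub_nonneg.2 hmono)
    have hcase : (|x + y| = |x| + |y| ∧ |x - y| = |x| - |y|) ∨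
        (|x + y| = |x| - |y| ∧ |x - y| = |x| + |y|) := by
      rcases abs_cases x with hx | hx <;> rcases abs_cases y with hy | hy <;>
      rcases abs_cases (x + y) with hs | hs <;> rcases abs_cases (x - y) with hd | hd <;>
      first
      | (left; constructor <;> linarith)
      | (right; constructor <;> linarith)
    rcases hcase with ⟨e1, e2⟩ | ⟨e1, e2⟩ <;> rw [e1, e2] <;> linarith
  intro x y
  rcases le_total |y| |x| with hle | hle
  · exact h2 x y hle
  · rw [add_comm x y, abs_sub_comm x y, add_comm (|x| ^ p)]
    exact h2 y x hle

theorem holder_two {p q : ℝ} (hpq : p.HolderConjugate q) (a b c d : ℝ) :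
    a * c + b * d ≤ (|a| ^ p + |b| ^ p) ^ (1 / p) * (|c| ^ q + |d| ^ q) ^ (1 / q) := by
  simpa using Real.inner_le_Lp_mul_Lq (Finset.univ : Finset (Fin 2)) ![a, b] ![c, d] hpq

/-- The scalar `u` for which `x * u` attains equality in Young's and Hölder's inequalities. -/
theorem exists_holder_dual {p q : ℝ} (hpq : p.HolderConjugate q) (x : ℝ) :
    ∃ u : ℝ, x * u = |x| ^ p ∧ |u| ^ q = |x| ^ p := by
  rcases eq_or_ne x 0 with rfl | hx
  · exact ⟨0, by simp [Real.zero_rpow hpq.ne_zero],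
      by simp [Real.zero_rpow hpq.ne_zero, Real.zero_rpow hpq.symm.ne_zero]⟩
  · refine ⟨|x| ^ p / x, mul_div_cancel₀ _ hx, ?_⟩
    have hx' := abs_pos.2 hx
    rw [abs_div, abs_of_nonneg (Real.rpow_nonneg hx'.le p), ← Real.rpow_sub_one hx'.ne',
      ← Real.rpow_mul hx'.le, hpq.sub_one_mul_conj]

/-- Hölder's inequality for the norm `(|a| ^ r + D |b| ^ r) ^ (1 / r)`, whose dual norm has the weight
`D ^ (-(s / r))`. -/
theorem holder_two_weighted {r s : ℝ} (hrs : r.HolderConjugate s) {D : ℝ} (hD : 0 < D)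
    (a b c d : ℝ) :
    a * c + b * d ≤
      (|a| ^ r + D * |b| ^ r) ^ (1 / r) * (|c| ^ s + D ^ (-(s / r)) * |d| ^ s) ^ (1 / s) := by
  have h := holder_two hrs a (D ^ (1 / r) * b) c (D ^ (-(1 / r)) * d)
  have e : D ^ (1 / r) * b * (D ^ (-(1 / r)) * d) = b * d := by
    rw [mul_mul_mul_comm, ← Real.rpow_add hD]; simp
  have e1 : |D ^ (1 / r) * b| ^ r = D * |b| ^ r := by
    rw [abs_mul, abs_of_nonneg (Real.rpow_nonneg hD.le _),
      Real.mul_rpow (Real.rpow_nonneg hD.le _) (abs_nonneg _), ← Real.rpow_mul hD.le,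
      one_div_mul_cancel hrs.ne_zero, Real.rpow_one]
  have e2 : |D ^ (-(1 / r)) * d| ^ s = D ^ (-(s / r)) * |d| ^ s := by
    rw [abs_mul, abs_of_nonneg (Real.rpow_nonneg hD.le _),
      Real.mul_rpow (Real.rpow_nonneg hD.le _) (abs_nonneg _), ← Real.rpow_mul hD.le]
    congr 2
    ring
  rwa [e, e1, e2] at h

theorem rpow_one_div_le_of_le_mul {N A B r s : ℝ} (hrs : r.HolderConjugate s) (hN : 0 ≤ N)
    (hB : 0 ≤ B) (hA : 0 ≤ A) (h : N ≤ A * (B * N ^ (1 / s))) : N ^ (1 / r) ≤ A * B := by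
  rcases hN.eq_or_lt with rfl | hN
  · rw [Real.zero_rpow (one_div_ne_zero hrs.ne_zero)]; positivity
  · have hp := Real.rpow_pos_of_pos hN (1 / s)
    refine le_of_mul_le_mul_right ?_ hp
    rw [← Real.rpow_add hN, hrs.one_div_add_one_div, div_one, Real.rpow_one]
    linarith

/-- Duality. Up to the factor `2 ^ (1 / p)`, the upper law says that `(a, b) ↦ (a + b, a - b)`
contracts a weighted `ℓ^r` norm into the `ℓ^p` norm, and the lower law that its transpose contracts
the `ℓ^q` norm into the dual weighted `ℓ^s` norm. -/
theorem TwoPointLower.upper {p q r s C : ℝ} (hpq : p.HolderConjugate q)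
    (hrs : r.HolderConjugate s) (hC : 0 < C) (h : TwoPointLower q s C) :
    TwoPointUpper p r (C ^ (-(r / s))) := by
  intro x y
  obtain ⟨u, hxu, hu⟩ := exists_holder_dual hpq x
  obtain ⟨v, hyv, hv⟩ := exists_holder_dual hpq y
  have hN : 0 ≤ |x| ^ p + |y| ^ p := by positivity
  have hD := Real.rpow_pos_of_pos hC (-(r / s))
  have hS : 0 ≤ |x + y| ^ r + C ^ (-(r / s)) * |x - y| ^ r := by positivity
  have h1 := holder_two_weighted hrs hD (x + y) (x - y) (u + v) (u - v)
  have h2 := h u v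
  have e1 : (C ^ (-(r / s))) ^ (-(s / r)) = C := by
    rw [← Real.rpow_mul hC.le, neg_mul_neg, div_mul_div_cancel₀' hrs.ne_zero,
      div_self hrs.symm.ne_zero, Real.rpow_one]
  have e2 : (x + y) * (u + v) + (x - y) * (u - v) = 2 * (|x| ^ p + |y| ^ p) := by
    rw [← hxu, ← hyv]; ring
  rw [e1, e2] at h1
  rw [hu, hv] at h2
  set N := |x| ^ p + |y| ^ p
  set S := |x + y| ^ r + C ^ (-(r / s)) * |x - y| ^ r
  have h3 : (|u + v| ^ s + C * |u - v| ^ s) ^ (1 / s) ≤ 2 ^ (1 - 1 / q) * N ^ (1 / q) := by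
    refine (Real.rpow_le_rpow (by positivity) h2 (by have := hrs.symm.pos; positivity)).trans_eq ?_
    have := hrs.symm.ne_zero
    have := hpq.symm.ne_zero
    rw [Real.mul_rpow (by positivity) (by positivity), ← Real.rpow_mul two_pos.le,
      ← Real.rpow_mul hN]
    congr 2 <;> field_simp
  have h4 : N ≤ S ^ (1 / r) * (2 ^ (-(1 / q)) * N ^ (1 / q)) := by
    have h5 := h1.trans (mul_le_mul_of_nonneg_left h3 (Real.rpow_nonneg hS _))
    rw [sub_eq_add_neg, Real.rpow_add two_pos, Real.rpow_one] at h5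
    linarith
  have h5 := rpow_one_div_le_of_le_mul hpq hN (by positivity) (by positivity) h4
  have h6 : 2 ^ (1 / q) * N ^ (1 / p) ≤ S ^ (1 / r) := by
    have := mul_le_mul_of_nonneg_left h5 (by positivity : (0 : ℝ) ≤ 2 ^ (1 / q))
    rwa [mul_left_comm, ← Real.rpow_add two_pos, add_neg_cancel, Real.rpow_zero, mul_one] at this
  have h7 := Real.rpow_le_rpow (by positivity) h6 hrs.nonneg
  rw [Real.mul_rpow (by positivity) (by positivity), ← Real.rpow_mul two_pos.le,
    ← Real.rpow_mul hN, ← Real.rpow_mul hS, one_div_mul_cancel hrs.ne_zero, Real.rpow_one] at h7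
  have e3 : r - r / p = 1 / q * r := by
    rw [one_div, ← hpq.one_sub_inv]; ring
  rwa [e3, ← one_div_mul_eq_div p r]

/-- The converse of `TwoPointLower.upper`, with the weight expressed through `D`. -/
theorem TwoPointUpper.lower {p q r s D : ℝ} (hpq : p.HolderConjugate q)
    (hrs : r.HolderConjugate s) (hD : 0 < D) (h : TwoPointUpper p r D) :
    TwoPointLower q s (D ^ (-(s / r))) := by
  intro x y
  obtain ⟨u, hxu, hu⟩ := exists_holder_dual hrs.symm (x + y)
  obtain ⟨v, hyv, hv⟩ := exists_holder_dual hrs.symm (x - y)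
  set C := D ^ (-(s / r)) with hCdef
  have hC : 0 < C := Real.rpow_pos_of_pos hD _
  have hDC : D * C ^ r = C := by
    have hr := hrs.ne_zero
    have : D ^ (1 : ℝ) * (D ^ (-(s / r))) ^ r = D ^ (-(s / r)) := by
      rw [← Real.rpow_mul hD.le, ← Real.rpow_add hD]
      congr 1
      field_simp
      linarith [hrs.mul_eq_add]
    rwa [Real.rpow_one] at this
  have hM : 0 ≤ |x| ^ q + |y| ^ q := by positivity
  have h1 := holder_two hpq.symm x y (u + C * v) (u - C * v)
  have h2 := h (u + C * v) (u - C * v)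
  have e1 : x * (u + C * v) + y * (u - C * v) = |x + y| ^ s + C * |x - y| ^ s := by
    rw [← hxu, ← hyv]; ring
  have e2 : |u + C * v + (u - C * v)| ^ r + D * |u + C * v - (u - C * v)| ^ r =
      2 ^ r * (|x + y| ^ s + C * |x - y| ^ s) := by
    have a1 : u + C * v + (u - C * v) = 2 * u := by ring
    have a2 : u + C * v - (u - C * v) = 2 * (C * v) := by ring
    rw [a1, a2, abs_mul, abs_mul, abs_mul, abs_of_pos hC, abs_two,
      Real.mul_rpow two_pos.le (abs_nonneg _), Real.mul_rpow two_pos.le (by positivity),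
      Real.mul_rpow hC.le (abs_nonneg _), hu, hv]
    linear_combination 2 ^ r * |x - y| ^ s * hDC
  rw [e1] at h1
  rw [e2] at h2
  have hS : 0 ≤ |x + y| ^ s + C * |x - y| ^ s := by positivity
  set S := |x + y| ^ s + C * |x - y| ^ s
  set K := |u + C * v| ^ p + |u - C * v| ^ p
  have hK : 0 ≤ K := by positivity
  have h3 : K ^ (1 / p) ≤ 2 ^ (1 / p) * S ^ (1 / r) := by
    have h4 : K ^ (r / p) ≤ 2 ^ (r / p) * S := by
      rw [Real.rpow_sub two_pos, div_mul_eq_mul_div, mul_div_assoc] at h2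
      have h2 := le_of_mul_le_mul_left h2 (by positivity)
      rwa [div_le_iff₀ (by positivity), mul_comm] at h2
    have h5 := Real.rpow_le_rpow (by positivity) h4 (by have := hrs.pos; positivity : 0 ≤ 1 / r)
    rw [Real.mul_rpow (by positivity) hS, ← Real.rpow_mul two_pos.le, ← Real.rpow_mul hK] at h5
    have e : r / p * (1 / r) = 1 / p := by
      have := hrs.ne_zero
      field_simp
    rwa [e] at h5
  have h4 : S ≤ (|x| ^ q + |y| ^ q) ^ (1 / q) * (2 ^ (1 / p) * S ^ (1 / r)) :=
    h1.trans (mul_le_mul_of_nonneg_left h3 (by positivity))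
  have h5 := rpow_one_div_le_of_le_mul hrs.symm hS (by positivity) (by positivity) h4
  have h7 := Real.rpow_le_rpow (by positivity) h5 hrs.symm.nonneg
  rw [Real.mul_rpow (by positivity) (by positivity), ← Real.rpow_mul two_pos.le,
    ← Real.rpow_mul hM, ← Real.rpow_mul hS, one_div_mul_cancel hrs.symm.ne_zero,
    Real.rpow_one] at h7
  have e3 : s - s / q = 1 / p * s := by
    rw [one_div, ← hpq.symm.one_sub_inv]; ring
  rw [e3, ← one_div_mul_eq_div q s, mul_comm]
  exact h7

/-! ### The constant `wpConst` -/

theorem two_le_rpow_add_rpow {e R : ℝ} (he : e ≤ 0) (h0 : 0 ≤ R) (h1 : R < 1) :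
    2 ≤ (1 + R) ^ e + (1 - R) ^ e := by
  have ha : 0 < (1 + R) ^ e := Real.rpow_pos_of_pos (by linarith) e
  have hb : 0 < (1 - R) ^ e := Real.rpow_pos_of_pos (by linarith) e
  have h : 1 ≤ (1 + R) ^ e * (1 - R) ^ e := by
    rw [← Real.mul_rpow (by linarith) (by linarith)]
    exact Real.one_le_rpow_of_pos_of_le_one_of_nonpos (by nlinarith) (by nlinarith) he
  nlinarith [sq_nonneg ((1 + R) ^ e - (1 - R) ^ e)]

theorem rpow_diff_lower {p R : ℝ} (hp : 1 < p) (hp2 : p ≤ 2) (h0 : 0 ≤ R) (h1 : R ≤ 1) :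
    2 * (p - 1) * R ≤ (1 + R) ^ (p - 1) - (1 - R) ^ (p - 1) := by
  have hd : ∀ x ∈ Set.Ioo (0 : ℝ) 1, HasDerivAt
      (fun x : ℝ => (1 + x) ^ (p - 1) - (1 - x) ^ (p - 1) - 2 * (p - 1) * x)
      ((p - 1) * ((1 + x) ^ (p - 2) + (1 - x) ^ (p - 2) - 2)) x := fun x hx => by
    have hx0 := hx.1
    have hx1 := hx.2
    have h1 := ((hasDerivAt_id' x).const_add 1).rpow_const (p := p - 1) (Or.inl (by linarith))
    have h2 := ((hasDerivAt_id' x).const_sub 1).rpow_const (p := p - 1) (Or.inl (by linarith))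
    refine ((h1.sub h2).sub ((hasDerivAt_id' x).const_mul (2 * (p - 1)))).congr_deriv ?_
    rw [show p - 1 - 1 = p - 2 by ring]
    ring
  have hm : MonotoneOn (fun x : ℝ => (1 + x) ^ (p - 1) - (1 - x) ^ (p - 1) - 2 * (p - 1) * x)
      (Set.Icc 0 1) := by
    refine monotoneOn_of_deriv_nonneg (convex_Icc 0 1) ?_ ?_ ?_
    · exact ((((continuous_const.add continuous_id).rpow_const fun _ => Or.inr (by linarith)).sub
        ((continuous_const.sub continuous_id).rpow_const fun _ => Or.inr (by linarith))).sub
        (continuous_const.mul continuous_id)).continuousOn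
    · rw [interior_Icc]
      exact fun x hx => (hd x hx).differentiableAt.differentiableWithinAt
    · rw [interior_Icc]
      intro x hx
      rw [(hd x hx).deriv]
      have := two_le_rpow_add_rpow (sub_nonpos.2 hp2) hx.1.le hx.2
      exact mul_nonneg (by linarith) (by linarith)
  have h := hm (Set.left_mem_Icc.2 zero_le_one) ⟨h0, h1⟩ h0
  simp only [add_zero, sub_zero, Real.one_rpow, mul_zero, sub_self] at h
  linarith

theorem rpow_sum_lower {p R : ℝ} (hp : 1 < p) (hp2 : p ≤ 2) (h0 : 0 ≤ R) (h1 : R ≤ 1) :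
    2 + p * (p - 1) * R ^ 2 ≤ (1 + R) ^ p + (1 - R) ^ p := by
  have hd : ∀ x ∈ Set.Ioo (0 : ℝ) 1, HasDerivAt
      (fun x : ℝ => (1 + x) ^ p + (1 - x) ^ p - p * (p - 1) * x ^ 2)
      (p * ((1 + x) ^ (p - 1) - (1 - x) ^ (p - 1) - 2 * (p - 1) * x)) x := fun x hx => by
    have hx0 := hx.1
    have hx1 := hx.2
    have h1 := ((hasDerivAt_id' x).const_add 1).rpow_const (p := p) (Or.inl (by linarith))
    have h2 := ((hasDerivAt_id' x).const_sub 1).rpow_const (p := p) (Or.inl (by linarith))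
    refine ((h1.add h2).sub ((hasDerivAt_pow 2 x).const_mul (p * (p - 1)))).congr_deriv ?_
    push_cast
    ring
  have hm : MonotoneOn (fun x : ℝ => (1 + x) ^ p + (1 - x) ^ p - p * (p - 1) * x ^ 2)
      (Set.Icc 0 1) := by
    refine monotoneOn_of_deriv_nonneg (convex_Icc 0 1) ?_ ?_ ?_
    · exact ((((continuous_const.add continuous_id).rpow_const fun _ => Or.inr (by linarith)).add
        ((continuous_const.sub continuous_id).rpow_const fun _ => Or.inr (by linarith))).sub
        (continuous_const.mul (continuous_pow 2))).continuousOn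
    · rw [interior_Icc]
      exact fun x hx => (hd x hx).differentiableAt.differentiableWithinAt
    · rw [interior_Icc]
      intro x hx
      rw [(hd x hx).deriv]
      have := rpow_diff_lower hp hp2 hx.1.le hx.2.le
      exact mul_nonneg (by linarith) (by linarith)
  have h := hm (Set.left_mem_Icc.2 zero_le_one) ⟨h0, h1⟩ h0
  simp only [add_zero, sub_zero, Real.one_rpow] at h
  linarith

/-- An explicit positive lower bound for the quotients in the definition of `wpConst p r`. It follows
from `rpow_sum_lower` at `R = (1 - t) / (1 + t)`, where `1 + R` and `1 - R` are proportional to `1`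
and `t`. -/
theorem one_add_rpow_add_sqrt_le {p r t : ℝ} (hp : 1 < p) (hp2 : p ≤ 2) (hr : 2 ≤ r)
    (h0 : 0 ≤ t) (h1 : t < 1) :
    (1 + t) ^ r + √(p - 1) ^ r * (1 - t) ^ r ≤ 2 ^ (r - r / p) * (1 + t ^ p) ^ (r / p) := by
  have hp0 : 0 < p := by linarith
  have hp1 : 0 ≤ p - 1 := by linarith
  set R := (1 - t) / (1 + t) with hR
  have ht : 0 < 1 + t := by linarith
  have hR0 : 0 ≤ R := div_nonneg (by linarith) ht.le
  have hR1 : R ≤ 1 := (div_le_one ht).2 (by linarith)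
  have a1 : 1 + √(p - 1) ^ r * R ^ r ≤ (1 + (p - 1) * R ^ 2) ^ (r / 2) := by
    have := rpow_add_rpow_le_rpow_div two_pos hr zero_le_one
      (mul_nonneg (Real.sqrt_nonneg (p - 1)) hR0)
    rwa [Real.one_rpow, Real.mul_rpow (Real.sqrt_nonneg _) hR0, Real.rpow_two, Real.rpow_two,
      mul_pow, Real.sq_sqrt hp1, one_pow] at this
  -- Bernoulli's inequality with the exponent `2 / p ≥ 1`
  have a2 : 1 + (p - 1) * R ^ 2 ≤ (((1 + R) ^ p + (1 - R) ^ p) / 2) ^ (2 / p) := by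
    have b1 := one_add_mul_self_le_rpow_one_add (s := p * (p - 1) / 2 * R ^ 2)
      (by have : 0 ≤ p * (p - 1) / 2 * R ^ 2 := by positivity
          linarith) (p := 2 / p) ((one_le_div hp0).2 hp2)
    have e : 2 / p * (p * (p - 1) / 2 * R ^ 2) = (p - 1) * R ^ 2 := by field_simp
    rw [e] at b1
    refine b1.trans (Real.rpow_le_rpow (by positivity) ?_ (by positivity))
    linarith [rpow_sum_lower hp hp2 hR0 hR1]
  have e1 : ((1 + R) ^ p + (1 - R) ^ p) / 2 = 2 ^ (p - 1) * (1 + t ^ p) / (1 + t) ^ p := by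
    have c1 : 1 + R = 2 / (1 + t) := by rw [hR]; field_simp; ring
    have c2 : 1 - R = 2 * t / (1 + t) := by rw [hR]; field_simp; ring
    rw [c1, c2, Real.div_rpow two_pos.le ht.le, Real.div_rpow (by positivity) ht.le,
      Real.mul_rpow two_pos.le h0, Real.rpow_sub_one two_ne_zero]
    ring
  clear_value R
  have hbase : 0 ≤ 2 ^ (p - 1) * (1 + t ^ p) / (1 + t) ^ p := by positivity
  rw [e1] at a2
  have a3 := a1.trans (Real.rpow_le_rpow (by positivity) a2 (by positivity))
  have e2 : 2 / p * (r / 2) = r / p := by field_simp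
  rw [← Real.rpow_mul hbase, e2, Real.div_rpow (by positivity) (by positivity),
    Real.mul_rpow (by positivity) (by positivity), ← Real.rpow_mul ht.le,
    ← Real.rpow_mul two_pos.le, mul_div_cancel₀ r hp0.ne', le_div_iff₀ (by positivity)] at a3
  have e3 : (p - 1) * (r / p) = r - r / p := by field_simp
  have e4 : R ^ r * (1 + t) ^ r = (1 - t) ^ r := by
    rw [hR, Real.div_rpow (by linarith) ht.le, div_mul_cancel₀ _ (by positivity)]
  rw [e3] at a3
  linear_combination a3 - √(p - 1) ^ r * e4

theorem le_wpConst {p r c : ℝ} (h : ∀ t ∈ Set.Ico (0 : ℝ) 1,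
    (1 + t) ^ r + c * (1 - t) ^ r ≤ 2 ^ (r - r / p) * (1 + t ^ p) ^ (r / p)) :
    c ≤ wpConst p r := by
  refine le_csInf ((Set.nonempty_Ico.2 zero_lt_one).image _) ?_
  rintro _ ⟨t, ht, rfl⟩
  rw [le_div_iff₀ (Real.rpow_pos_of_pos (by linarith [ht.2]) r)]
  linarith [h t ht]

theorem wpConst_pos {p r : ℝ} (hp : 1 < p) (hp2 : p ≤ 2) (hr : 2 ≤ r) : 0 < wpConst p r :=
  (Real.rpow_pos_of_pos (Real.sqrt_pos.2 (sub_pos.2 hp)) r).trans_le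
    (le_wpConst fun _ ht => one_add_rpow_add_sqrt_le hp hp2 hr ht.1 ht.2)

theorem wpConst_le {p r t : ℝ} (hp : 1 < p) (hp2 : p ≤ 2) (hr : 2 ≤ r)
    (ht : t ∈ Set.Ico (0 : ℝ) 1) :
    wpConst p r ≤
      (2 ^ (r - r / p) * (1 + t ^ p) ^ (r / p) - (1 + t) ^ r) / (1 - t) ^ r := by
  refine csInf_le ⟨√(p - 1) ^ r, ?_⟩ ⟨t, ht, rfl⟩
  rintro _ ⟨t, ht, rfl⟩
  rw [le_div_iff₀ (Real.rpow_pos_of_pos (by linarith [ht.2]) r)]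
  linarith [one_add_rpow_add_sqrt_le hp hp2 hr ht.1 ht.2]

theorem twoPointLower_wpConst {p q r : ℝ} (hpq : p.HolderConjugate q) (hp2 : p ≤ 2) (hr : 2 ≤ r)
    (hrq : r ≤ q) : TwoPointLower p r (wpConst p r) := by
  refine twoPointLower_of_Ico hpq.pos (by linarith) ?_ fun t ht => ?_
  · refine (wpConst_le hpq.lt hp2 hr (Set.left_mem_Ico.2 zero_lt_one)).trans ?_
    have e : r - r / p = r / q := by rw [div_eq_mul_inv r q, ← hpq.one_sub_inv]; ring
    have h := Real.rpow_le_rpow_of_exponent_le one_le_two ((div_le_one hpq.symm.pos).2 hrq)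
    rw [Real.rpow_one] at h
    simp only [Real.zero_rpow hpq.ne_zero, add_zero, sub_zero, Real.one_rpow, mul_one, div_one, e]
    linarith
  · have h := wpConst_le hpq.lt hp2 hr ht
    rw [le_div_iff₀ (Real.rpow_pos_of_pos (by linarith [ht.2]) r)] at h
    linarith

theorem TwoPointLower.le_wpConst {p r C : ℝ} (h : TwoPointLower p r C) : C ≤ wpConst p r := by
  refine _root_.le_wpConst fun t ht => ?_
  have := h 1 t
  have ht0 := ht.1
  rwa [abs_of_nonneg (by linarith : 0 ≤ 1 + t), abs_of_pos (by linarith [ht.2] : 0 < 1 - t),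
    abs_one, Real.one_rpow, abs_of_nonneg ht0] at this

theorem Real.HolderConjugate.two_le_of_le_two {p q : ℝ} (hpq : p.HolderConjugate q)
    (hp : p ≤ 2) : 2 ≤ q := by
  nlinarith [hpq.sub_one_mul_conj, hpq.mul_eq_add, hpq.symm.pos, hpq.lt]

theorem Real.HolderConjugate.le_two_of_two_le {p q : ℝ} (hpq : p.HolderConjugate q)
    (hp : 2 ≤ p) : q ≤ 2 := by
  nlinarith [hpq.sub_one_mul_conj, hpq.mul_eq_add, hpq.symm.pos, hpq.lt]

theorem twoPointLower_one {p q : ℝ} (hpq : p.HolderConjugate q) (hp2 : p ≤ 2) :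
    TwoPointLower p q 1 := by
  have hq := hpq.two_le_of_le_two hp2
  refine twoPointLower_of_Ico hpq.pos hpq.symm.pos le_rfl fun t ht => ?_
  have h := clarkson_two_point hpq.symm hq ht.1 ht.2.le
  rwa [hpq.symm.div_conj_eq_sub_one, sub_sub_cancel, Real.rpow_one, one_mul]

/-! ### Weak parallelogram laws in normed spaces -/

/-- Hanner's inequality with exponent `p`: as stated for `ε = 1` (the case `p ≥ 2`), reversed for
`ε = -1` (the case `p ≤ 2`). -/
def IsHanner (X : Type*) [NormedAddCommGroup X] (p ε : ℝ) : Prop :=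
  ∀ u v : X, ε * (‖u + v‖ ^ p + ‖u - v‖ ^ p) ≤ ε * ((‖u‖ + ‖v‖) ^ p + |‖u‖ - ‖v‖| ^ p)

section

variable {X : Type*} [NormedAddCommGroup X]

theorem IsLWP.mono_one {r s : ℝ} (h : IsLWP X r 1) (hrs : r ≤ s) : IsLWP X s 1 := by
  obtain ⟨hr, -, h⟩ := h
  have hr0 : 0 < r := by linarith
  have hs0 : 0 < s := by linarith
  refine ⟨hr.trans_le hrs, one_pos, fun x y => ?_⟩
  have h1 := rpow_add_rpow_le_rpow_div hr0 hrs (norm_nonneg (x + y)) (norm_nonneg (x - y))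
  have h2 := rpow_div_le_mul_rpow_add_rpow hr0 hrs (norm_nonneg x) (norm_nonneg y)
  have h3 := h x y
  rw [one_mul] at h3 ⊢
  refine h1.trans ((Real.rpow_le_rpow (by positivity) h3 (by positivity)).trans ?_)
  rw [Real.mul_rpow (by positivity) (by positivity), ← Real.rpow_mul two_pos.le]
  refine (mul_le_mul_of_nonneg_left h2 (by positivity)).trans_eq ?_
  rw [← mul_assoc, ← Real.rpow_add two_pos]
  congr 2
  field_simp
  ring

theorem IsUWP.mono_one {r s : ℝ} (h : IsUWP X s 1) (hr : 1 < r) (hrs : r ≤ s) : IsUWP X r 1 := by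
  obtain ⟨hs, -, h⟩ := h
  have hr0 : 0 < r := by linarith
  have hs0 : 0 < s := by linarith
  refine ⟨hr, one_pos, fun x y => ?_⟩
  have h1 := rpow_add_rpow_le_rpow_div hr0 hrs (norm_nonneg (x + y)) (norm_nonneg (x - y))
  have h2 := rpow_div_le_mul_rpow_add_rpow hr0 hrs (norm_nonneg x) (norm_nonneg y)
  have h3 := h x y
  rw [one_mul] at h3 ⊢
  refine (Real.rpow_le_rpow_iff (z := s / r) (by positivity) (by positivity)
    (by positivity)).1 (le_trans ?_ (h3.trans h1))
  rw [Real.mul_rpow (by positivity) (by positivity), ← Real.rpow_mul two_pos.le]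
  refine (mul_le_mul_of_nonneg_left h2 (by positivity)).trans_eq ?_
  rw [← mul_assoc, ← Real.rpow_add two_pos]
  congr 2
  field_simp
  ring

variable [NormedSpace ℝ X]

theorem IsLWP.isOptimal_one [Nontrivial X] {r : ℝ} (h : IsLWP X r 1) : IsOptimalLWP X r 1 := by
  refine ⟨h, fun C hC => ?_⟩
  obtain ⟨hr, -, hC⟩ := hC
  obtain ⟨v, hv⟩ := exists_norm_ne_zero X
  have hv : 0 < ‖v‖ ^ r := Real.rpow_pos_of_pos (lt_of_le_of_ne (norm_nonneg v) hv.symm) r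
  have h1 := hC v (-v)
  have e : ‖v + v‖ = 2 * ‖v‖ := by rw [← two_smul ℝ v, norm_smul]; simp
  rw [add_neg_cancel, norm_zero, sub_neg_eq_add, norm_neg, Real.zero_rpow (by linarith), zero_add,
    e, Real.mul_rpow two_pos.le (norm_nonneg v), Real.rpow_sub_one two_ne_zero] at h1
  have h2 : (0 : ℝ) < 2 ^ r * ‖v‖ ^ r := by positivity
  refine le_of_mul_le_mul_right ?_ h2
  linarith

theorem IsUWP.isOptimal_one [Nontrivial X] {r : ℝ} (h : IsUWP X r 1) : IsOptimalUWP X r 1 := by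
  refine ⟨h, fun C hC => ?_⟩
  obtain ⟨hr, -, hC⟩ := hC
  obtain ⟨v, hv⟩ := exists_norm_ne_zero X
  have hv : 0 < ‖v‖ ^ r := Real.rpow_pos_of_pos (lt_of_le_of_ne (norm_nonneg v) hv.symm) r
  have h1 := hC v (-v)
  have e : ‖v + v‖ = 2 * ‖v‖ := by rw [← two_smul ℝ v, norm_smul]; simp
  rw [add_neg_cancel, norm_zero, sub_neg_eq_add, norm_neg, Real.zero_rpow (by linarith), zero_add,
    e, Real.mul_rpow two_pos.le (norm_nonneg v), Real.rpow_sub_one two_ne_zero] at h1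
  have h2 : (0 : ℝ) < 2 ^ r * ‖v‖ ^ r := by positivity
  refine le_of_mul_le_mul_right ?_ h2
  linarith

theorem two_rpow_mul_norm_add_norm (x y : X) {p : ℝ} :
    2 ^ p * (‖x‖ ^ p + ‖y‖ ^ p) = ‖(x + y) + (x - y)‖ ^ p + ‖(x + y) - (x - y)‖ ^ p := by
  have e1 : (x + y) + (x - y) = (2 : ℝ) • x := by rw [two_smul]; abel
  have e2 : (x + y) - (x - y) = (2 : ℝ) • y := by rw [two_smul]; abel
  rw [e1, e2, norm_smul, norm_smul, Real.mul_rpow (norm_nonneg _) (norm_nonneg _),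
    Real.mul_rpow (norm_nonneg _) (norm_nonneg _), Real.norm_two]
  ring

theorem half_sum_rpow {a b p : ℝ} (ha : 0 ≤ a) (hb : 0 ≤ b) :
    2 ^ p * (|(a + b) / 2| ^ p + |(a - b) / 2| ^ p) = (a + b) ^ p + |a - b| ^ p := by
  rw [abs_div, abs_div, abs_two, Real.div_rpow (abs_nonneg _) two_pos.le,
    Real.div_rpow (abs_nonneg _) two_pos.le, abs_of_nonneg (add_nonneg ha hb)]
  field_simp

/-- Hanner's inequality for `x + y` and `x - y` bounds `‖x‖ ^ p + ‖y‖ ^ p` below by its value in the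
`ℓ^p` plane; the power mean inequality passes from `p` to `r`. -/
theorem IsHanner.isLWP {p r C : ℝ} (h : IsHanner X p (-1)) (hp : 0 < p) (hpr : p ≤ r) (hr : 1 < r)
    (hC : 0 < C) (hT : TwoPointLower p r C) : IsLWP X r C := by
  refine ⟨hr, hC, fun x y => ?_⟩
  have h1 := h (x + y) (x - y)
  rw [← two_rpow_mul_norm_add_norm, ← half_sum_rpow (norm_nonneg _) (norm_nonneg _)] at h1
  set a := (‖x + y‖ + ‖x - y‖) / 2 with ha
  set b := (‖x + y‖ - ‖x - y‖) / 2 with hb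
  have h2 : |a| ^ p + |b| ^ p ≤ ‖x‖ ^ p + ‖y‖ ^ p :=
    le_of_mul_le_mul_left (by linarith) (Real.rpow_pos_of_pos two_pos p)
  have h3 := hT a b
  have e1 : a + b = ‖x + y‖ := by rw [ha, hb]; ring
  have e2 : a - b = ‖x - y‖ := by rw [ha, hb]; ring
  rw [e1, e2, abs_norm, abs_norm] at h3
  have h4 := rpow_div_le_mul_rpow_add_rpow hp hpr (norm_nonneg x) (norm_nonneg y)
  have h5 := Real.rpow_le_rpow (by positivity) h2 (by positivity : 0 ≤ r / p)
  have e3 : (2 : ℝ) ^ (r - 1) = 2 ^ (r - r / p) * 2 ^ (r / p - 1) := by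
    rw [← Real.rpow_add two_pos]; ring_nf
  rw [e3, mul_assoc]
  exact h3.trans (mul_le_mul_of_nonneg_left (h5.trans h4) (by positivity))

theorem IsHanner.isUWP {p r D : ℝ} (h : IsHanner X p 1) (hr : 1 < r) (hrp : r ≤ p)
    (hD : 0 < D) (hT : TwoPointUpper p r D) : IsUWP X r D := by
  refine ⟨hr, hD, fun x y => ?_⟩
  have hr0 : 0 < r := by linarith
  have hp : 0 < p := by linarith
  have h1 := h (x + y) (x - y)
  rw [← two_rpow_mul_norm_add_norm, ← half_sum_rpow (norm_nonneg _) (norm_nonneg _)] at h1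
  set a := (‖x + y‖ + ‖x - y‖) / 2 with ha
  set b := (‖x + y‖ - ‖x - y‖) / 2 with hb
  have h2 : ‖x‖ ^ p + ‖y‖ ^ p ≤ |a| ^ p + |b| ^ p :=
    le_of_mul_le_mul_left (by linarith) (Real.rpow_pos_of_pos two_pos p)
  have h3 := hT a b
  have e1 : a + b = ‖x + y‖ := by rw [ha, hb]; ring
  have e2 : a - b = ‖x - y‖ := by rw [ha, hb]; ring
  rw [e1, e2, abs_norm, abs_norm] at h3
  have h4 := rpow_div_le_mul_rpow_add_rpow hr0 hrp (norm_nonneg x) (norm_nonneg y)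
  have h5 := Real.rpow_le_rpow (by positivity) (h4.trans
    (mul_le_mul_of_nonneg_left h2 (by positivity))) (by positivity : 0 ≤ r / p)
  have hs : 0 ≤ ‖x‖ ^ r + ‖y‖ ^ r := by positivity
  have e4 : p / r * (r / p) = 1 := by field_simp
  have e5 : (p / r - 1) * (r / p) = 1 - r / p := by field_simp
  rw [← Real.rpow_mul hs, e4, Real.rpow_one, Real.mul_rpow (by positivity) (by positivity),
    ← Real.rpow_mul two_pos.le, e5] at h5
  refine le_trans ?_ h3
  have e3 : (2 : ℝ) ^ (r - r / p) = 2 ^ (r - 1) * 2 ^ (1 - r / p) := by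
    rw [← Real.rpow_add two_pos]; ring_nf
  rw [e3, mul_assoc]
  exact mul_le_mul_of_nonneg_left h5 (by positivity)

variable {p r : ℝ} {e₁ e₂ : X}

/-! ### Isometric copies of the real `ℓ^p` plane -/

theorem norm_rpow_of_plane (hp : 0 < p)
    (he : ∀ a b : ℝ, ‖a • e₁ + b • e₂‖ ^ p = |a| ^ p + |b| ^ p) (a b : ℝ) :
    ‖a • e₁ + b • e₂‖ ^ r = (|a| ^ p + |b| ^ p) ^ (r / p) := by
  rw [← he, ← Real.rpow_mul (norm_nonneg _), mul_div_cancel₀ r hp.ne']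

theorem norm_rpow_of_plane_diag (hp : 0 < p)
    (he : ∀ a b : ℝ, ‖a • e₁ + b • e₂‖ ^ p = |a| ^ p + |b| ^ p) {a b : ℝ} (hab : |b| = |a|) :
    ‖a • e₁ + b • e₂‖ ^ r = 2 ^ (r / p) * |a| ^ r := by
  rw [norm_rpow_of_plane hp he, hab, ← two_mul, Real.mul_rpow two_pos.le (by positivity),
    ← Real.rpow_mul (abs_nonneg a), mul_div_cancel₀ r hp.ne']

theorem IsLWP.twoPointLower {C : ℝ} (h : IsLWP X r C) (hp : 0 < p)
    (he : ∀ a b : ℝ, ‖a • e₁ + b • e₂‖ ^ p = |a| ^ p + |b| ^ p) : TwoPointLower p r C := by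
  intro x y
  have h1 := h.2.2 (x • e₁ + y • e₂) (y • e₁ + x • e₂)
  have a1 : x • e₁ + y • e₂ + (y • e₁ + x • e₂) = (x + y) • e₁ + (x + y) • e₂ := by module
  have a2 : x • e₁ + y • e₂ - (y • e₁ + x • e₂) = (x - y) • e₁ + (y - x) • e₂ := by module
  rw [a1, a2, norm_rpow_of_plane_diag hp he rfl, norm_rpow_of_plane_diag hp he (abs_sub_comm y x),
    norm_rpow_of_plane hp he, norm_rpow_of_plane hp he, add_comm (|y| ^ p)] at h1
  have h2 : (0 : ℝ) < 2 ^ (r / p) := by positivity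
  refine le_of_mul_le_mul_left ?_ h2
  rw [← mul_assoc (2 ^ (r / p)), ← Real.rpow_add two_pos, add_sub_cancel]
  rw [Real.rpow_sub_one two_ne_zero] at h1
  linarith

theorem IsUWP.twoPointUpper {D : ℝ} (h : IsUWP X r D) (hp : 0 < p)
    (he : ∀ a b : ℝ, ‖a • e₁ + b • e₂‖ ^ p = |a| ^ p + |b| ^ p) : TwoPointUpper p r D := by
  intro x y
  have h1 := h.2.2 (x • e₁ + y • e₂) (y • e₁ + x • e₂)
  have a1 : x • e₁ + y • e₂ + (y • e₁ + x • e₂) = (x + y) • e₁ + (x + y) • e₂ := by module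
  have a2 : x • e₁ + y • e₂ - (y • e₁ + x • e₂) = (x - y) • e₁ + (y - x) • e₂ := by module
  rw [a1, a2, norm_rpow_of_plane_diag hp he rfl, norm_rpow_of_plane_diag hp he (abs_sub_comm y x),
    norm_rpow_of_plane hp he, norm_rpow_of_plane hp he, add_comm (|y| ^ p)] at h1
  have h2 : (0 : ℝ) < 2 ^ (r / p) := by positivity
  refine le_of_mul_le_mul_left ?_ h2
  rw [← mul_assoc (2 ^ (r / p)), ← Real.rpow_add two_pos, add_sub_cancel]
  rw [Real.rpow_sub_one two_ne_zero] at h1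
  linarith

end

/-! ### The spaces `L^p` -/

section

variable {𝕜 : Type*} [RCLike 𝕜] {Ω : Type*} [MeasurableSpace Ω] {μ : Measure Ω} {p : ℝ}

theorem Lp_integrable_norm_rpow (hp : 0 < p) (f : Lp 𝕜 (ENNReal.ofReal p) μ) :
    Integrable (fun x => ‖f x‖ ^ p) μ := by
  have := (Lp.memLp f).integrable_norm_rpow (ENNReal.ofReal_pos.2 hp).ne' ENNReal.ofReal_ne_top
  rwa [ENNReal.toReal_ofReal hp.le] at this

theorem Lp_norm_rpow_eq_integral (hp : 0 < p) (f : Lp 𝕜 (ENNReal.ofReal p) μ) :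
    ‖f‖ ^ p = ∫ x, ‖f x‖ ^ p ∂μ := by
  have h0 : 0 ≤ ∫ x, ‖f x‖ ^ p ∂μ := integral_nonneg fun x => by positivity
  rw [Lp.norm_def, (Lp.memLp f).eLpNorm_eq_integral_rpow_norm (ENNReal.ofReal_pos.2 hp).ne'
    ENNReal.ofReal_ne_top, ENNReal.toReal_ofReal hp.le, ENNReal.toReal_ofReal (by positivity),
    ← Real.rpow_mul h0, inv_mul_cancel₀ hp.ne', Real.rpow_one]

/-- A pointwise inequality between `p`-th powers of norms passes to the `p`-th powers of `L^p`
norms by integration. -/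
theorem Lp_norm_ineq (hp : 0 < p) {c₁ c₂ c₃ c₄ : ℝ}
    (h : ∀ a b : 𝕜, 0 ≤ c₁ * ‖a + b‖ ^ p + c₂ * ‖a - b‖ ^ p + c₃ * ‖a‖ ^ p + c₄ * ‖b‖ ^ p)
    (f g : Lp 𝕜 (ENNReal.ofReal p) μ) :
    0 ≤ c₁ * ‖f + g‖ ^ p + c₂ * ‖f - g‖ ^ p + c₃ * ‖f‖ ^ p + c₄ * ‖g‖ ^ p := by
  have i₁ := (Lp_integrable_norm_rpow hp (f + g)).const_mul c₁
  have i₂ := (Lp_integrable_norm_rpow hp (f - g)).const_mul c₂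
  have i₃ := (Lp_integrable_norm_rpow hp f).const_mul c₃
  have i₄ := (Lp_integrable_norm_rpow hp g).const_mul c₄
  simp only [Lp_norm_rpow_eq_integral hp, ← integral_const_mul]
  rw [← integral_add i₁ i₂, ← integral_add (by exact i₁.add i₂) i₃,
    ← integral_add (by exact (i₁.add i₂).add i₃) i₄]
  refine integral_nonneg_of_ae ?_
  filter_upwards [Lp.coeFn_add f g, Lp.coeFn_sub f g] with x h1 h2
  simp only [Pi.zero_apply, h1, h2, Pi.add_apply, Pi.sub_apply]
  exact h (f x) (g x)

variable [Fact (1 ≤ ENNReal.ofReal p)]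

/-- Hanner's inequality in `L^p`: integrate the tangent line inequality with `s = ‖v‖ / ‖u‖`, the
slope for which it is an equality at the norms. -/
theorem Lp_isHanner {ε : ℝ} (hp : 1 < p) (hε : HannerSign p ε) :
    IsHanner (Lp 𝕜 (ENNReal.ofReal p) μ) p ε := by
  have hp0 : 0 < p := by linarith
  have key : ∀ u v : Lp 𝕜 (ENNReal.ofReal p) μ, ‖v‖ ≤ ‖u‖ →
      ε * (‖u + v‖ ^ p + ‖u - v‖ ^ p) ≤ ε * ((‖u‖ + ‖v‖) ^ p + |‖u‖ - ‖v‖| ^ p) := by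
    intro u v hvu
    rcases eq_or_ne v 0 with rfl | hv
    · simp
    have hv := norm_pos_iff.2 hv
    have hu := hv.trans_le hvu
    set s := ‖v‖ / ‖u‖ with hs
    have hs0 : 0 < s := div_pos hv hu
    have hs1 : s ≤ 1 := (div_le_one hu).2 hvu
    have h1 := Lp_norm_ineq (c₁ := -ε) (c₂ := -ε) (c₃ := ε * hannerA p s) (c₄ := ε * hannerB p s)
      hp0 (fun a b : 𝕜 => by
        have := (hanner_norm hp0.le hε a b).trans
          (hanner_tangent hp hε hs0 hs1 (norm_nonneg a) (norm_nonneg b))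
        linarith) u v
    have h2 := hannerA_add_hannerB_self hp hs0 hs1
    have e0 : s * ‖u‖ = ‖v‖ := div_mul_cancel₀ _ hu.ne'
    have e1 : (‖u‖ + ‖v‖) ^ p = (1 + s) ^ p * ‖u‖ ^ p := by
      rw [← Real.mul_rpow (by linarith) hu.le, add_mul, e0, one_mul]
    have e2 : |‖u‖ - ‖v‖| ^ p = (1 - s) ^ p * ‖u‖ ^ p := by
      rw [abs_of_nonneg (sub_nonneg.2 hvu), ← Real.mul_rpow (by linarith) hu.le, sub_mul, e0,
        one_mul]
    have e3 : ‖v‖ ^ p = s ^ p * ‖u‖ ^ p := by rw [← Real.mul_rpow hs0.le hu.le, e0]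
    rw [e1, e2]
    rw [e3] at h1
    linear_combination h1 + ε * ‖u‖ ^ p * h2
  intro u v
  rcases le_total ‖v‖ ‖u‖ with h | h
  · exact key u v h
  · rw [add_comm u v, norm_sub_rev u v, add_comm ‖u‖, abs_sub_comm]
    exact key v u h

theorem Lp_isLWP_self (hp : 2 ≤ p) : IsLWP (Lp 𝕜 (ENNReal.ofReal p) μ) p 1 := by
  refine ⟨by linarith, one_pos, fun x y => ?_⟩
  have h := Lp_norm_ineq (μ := μ) (c₁ := 1) (c₂ := 1) (c₃ := -2) (c₄ := -2) (by linarith)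
    (fun a b : 𝕜 => by linarith [clarkson_norm_of_two_le hp a b]) (x + y) (x - y)
  have h2 := two_rpow_mul_norm_add_norm x y (p := p)
  rw [Real.rpow_sub_one two_ne_zero]
  linarith

theorem Lp_isUWP_self (hp1 : 1 < p) (hp : p ≤ 2) : IsUWP (Lp 𝕜 (ENNReal.ofReal p) μ) p 1 := by
  refine ⟨hp1, one_pos, fun x y => ?_⟩
  have h := Lp_norm_ineq (μ := μ) (c₁ := -1) (c₂ := -1) (c₃ := 2) (c₄ := 2) (by linarith)
    (fun a b : 𝕜 => by linarith [clarkson_norm_of_le_two (by linarith) hp a b]) (x + y) (x - y)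
  have h2 := two_rpow_mul_norm_add_norm x y (p := p)
  rw [Real.rpow_sub_one two_ne_zero]
  linarith

theorem indicatorConstLp_one_ne_zero (hp : 0 < p) {A : Set Ω} (hA : MeasurableSet A)
    (h0 : μ A ≠ 0) (hfin : μ A ≠ ∞) :
    indicatorConstLp (ENNReal.ofReal p) hA hfin (1 : 𝕜) ≠ 0 := by
  rw [← norm_ne_zero_iff, norm_indicatorConstLp (ENNReal.ofReal_pos.2 hp).ne'
    ENNReal.ofReal_ne_top, norm_one, one_mul]
  exact (Real.rpow_pos_of_pos (ENNReal.toReal_pos h0 hfin) _).ne'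

theorem HasPosFiniteSet.nontrivial_Lp (hp : 0 < p) (h : HasPosFiniteSet μ) :
    Nontrivial (Lp 𝕜 (ENNReal.ofReal p) μ) := by
  obtain ⟨A, hA, h0, hfin⟩ := h
  exact ⟨_, 0, indicatorConstLp_one_ne_zero hp hA h0 hfin⟩

/-- The normalized indicators of two disjoint sets span a real `ℓ^p` plane in `L^p`. -/
theorem HasTwoPosFiniteSets.exists_plane (hp : 0 < p) (h : HasTwoPosFiniteSets μ) :
    ∃ e₁ e₂ : Lp 𝕜 (ENNReal.ofReal p) μ,
      ∀ a b : ℝ, ‖a • e₁ + b • e₂‖ ^ p = |a| ^ p + |b| ^ p := by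
  obtain ⟨A, B, hA, hB, hAB, hA0, hAfin, hB0, hBfin⟩ := h
  set f := indicatorConstLp (ENNReal.ofReal p) hA hAfin (1 : 𝕜)
  set g := indicatorConstLp (ENNReal.ofReal p) hB hBfin (1 : 𝕜)
  have hf : ‖f‖ ≠ 0 := norm_ne_zero_iff.2 (indicatorConstLp_one_ne_zero hp hA hA0 hAfin)
  have hg : ‖g‖ ≠ 0 := norm_ne_zero_iff.2 (indicatorConstLp_one_ne_zero hp hB hB0 hBfin)
  have hadd : ∀ a b : ℝ, ‖a • f + b • g‖ ^ p = ‖a • f‖ ^ p + ‖b • g‖ ^ p := by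
    intro a b
    simp only [Lp_norm_rpow_eq_integral hp]
    rw [← integral_add (Lp_integrable_norm_rpow hp _) (Lp_integrable_norm_rpow hp _)]
    refine integral_congr_ae ?_
    filter_upwards [Lp.coeFn_add (a • f) (b • g), Lp.coeFn_smul a f, Lp.coeFn_smul b g,
      indicatorConstLp_coeFn_notMem (p := ENNReal.ofReal p) (hs := hA) (hμs := hAfin) (c := (1 : 𝕜)),
      indicatorConstLp_coeFn_notMem (p := ENNReal.ofReal p) (hs := hB) (hμs := hBfin) (c := (1 : 𝕜))]
      with x h1 h2 h3 h4 h5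
    rw [h1, Pi.add_apply, h2, h3, Pi.smul_apply, Pi.smul_apply]
    by_cases hx : x ∈ A
    · rw [h5 (Set.disjoint_left.1 hAB hx)]
      simp [Real.zero_rpow hp.ne']
    · rw [h4 hx]
      simp [Real.zero_rpow hp.ne']
  refine ⟨‖f‖⁻¹ • f, ‖g‖⁻¹ • g, fun a b => ?_⟩
  rw [smul_smul, smul_smul, hadd, norm_smul, norm_smul, norm_mul, norm_mul, norm_inv, norm_inv,
    norm_norm, norm_norm, mul_assoc, mul_assoc, inv_mul_cancel₀ hf, inv_mul_cancel₀ hg, mul_one,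
    mul_one, Real.norm_eq_abs, Real.norm_eq_abs]

end

/-! ### Optimal constants in `L^p` -/

theorem theorem1 {𝕜 : Type*} [RCLike 𝕜] {Ω : Type*} [MeasurableSpace Ω] (μ : Measure Ω)
    (p q : ℝ) (hpq : p.HolderConjugate q) [Fact (1 ≤ ENNReal.ofReal p)] :
    (p ≤ 2 →
      (∀ r : ℝ, 1 < r → r ≤ p →
        IsUWP (Lp 𝕜 (ENNReal.ofReal p) μ) r 1 ∧
        (HasPosFiniteSet μ → IsOptimalUWP (Lp 𝕜 (ENNReal.ofReal p) μ) r 1)) ∧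
      (∀ r : ℝ, 2 ≤ r → r ≤ q →
        IsLWP (Lp 𝕜 (ENNReal.ofReal p) μ) r (wpConst p r) ∧
        (HasTwoPosFiniteSets μ →
          IsOptimalLWP (Lp 𝕜 (ENNReal.ofReal p) μ) r (wpConst p r))) ∧
      (∀ r : ℝ, q ≤ r →
        IsLWP (Lp 𝕜 (ENNReal.ofReal p) μ) r 1 ∧
        (HasPosFiniteSet μ → IsOptimalLWP (Lp 𝕜 (ENNReal.ofReal p) μ) r 1))) ∧
    (2 ≤ p →
      (∀ r : ℝ, p ≤ r →
        IsLWP (Lp 𝕜 (ENNReal.ofReal p) μ) r 1 ∧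
        (HasPosFiniteSet μ → IsOptimalLWP (Lp 𝕜 (ENNReal.ofReal p) μ) r 1)) ∧
      (∀ r r' : ℝ, r.HolderConjugate r' → q ≤ r → r ≤ 2 →
        IsUWP (Lp 𝕜 (ENNReal.ofReal p) μ) r (wpConst q r' ^ (-(r / r'))) ∧
        (HasTwoPosFiniteSets μ →
          IsOptimalUWP (Lp 𝕜 (ENNReal.ofReal p) μ) r (wpConst q r' ^ (-(r / r'))))) ∧
      (∀ r : ℝ, 1 < r → r ≤ q →
        IsUWP (Lp 𝕜 (ENNReal.ofReal p) μ) r 1 ∧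
        (HasPosFiniteSet μ → IsOptimalUWP (Lp 𝕜 (ENNReal.ofReal p) μ) r 1))) := by
  have hp := hpq.lt
  have hp0 := hpq.pos
  have optL : ∀ {r}, IsLWP (Lp 𝕜 (ENNReal.ofReal p) μ) r 1 →
      IsLWP (Lp 𝕜 (ENNReal.ofReal p) μ) r 1 ∧
        (HasPosFiniteSet μ → IsOptimalLWP (Lp 𝕜 (ENNReal.ofReal p) μ) r 1) := fun h =>
    ⟨h, fun hμ => by
      have := hμ.nontrivial_Lp (𝕜 := 𝕜) hp0
      exact h.isOptimal_one⟩
  have optU : ∀ {r}, IsUWP (Lp 𝕜 (ENNReal.ofReal p) μ) r 1 →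
      IsUWP (Lp 𝕜 (ENNReal.ofReal p) μ) r 1 ∧
        (HasPosFiniteSet μ → IsOptimalUWP (Lp 𝕜 (ENNReal.ofReal p) μ) r 1) := fun h =>
    ⟨h, fun hμ => by
      have := hμ.nontrivial_Lp (𝕜 := 𝕜) hp0
      exact h.isOptimal_one⟩
  refine ⟨fun hp2 => ⟨fun r hr hrp => ?_, fun r hr hrq => ?_, fun r hqr => ?_⟩,
    fun hp2 => ⟨fun r hpr => ?_, fun r r' hr hqr hr2 => ?_, fun r hr hrq => ?_⟩⟩
  · exact optU ((Lp_isUWP_self hp hp2).mono_one hr hrp)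
  · have h : IsLWP (Lp 𝕜 (ENNReal.ofReal p) μ) r (wpConst p r) :=
      (Lp_isHanner hp (Or.inr ⟨rfl, hp2⟩)).isLWP hp0 (hp2.trans hr) (by linarith)
        (wpConst_pos hp hp2 hr) (twoPointLower_wpConst hpq hp2 hr hrq)
    refine ⟨h, fun hμ => ⟨h, fun C hC => ?_⟩⟩
    obtain ⟨e₁, e₂, he⟩ := hμ.exists_plane (𝕜 := 𝕜) hp0
    exact (IsLWP.twoPointLower hC hp0 he).le_wpConst
  · have h : IsLWP (Lp 𝕜 (ENNReal.ofReal p) μ) q 1 :=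
      (Lp_isHanner hp (Or.inr ⟨rfl, hp2⟩)).isLWP hp0 (hp2.trans (hpq.two_le_of_le_two hp2))
        hpq.symm.lt one_pos (twoPointLower_one hpq hp2)
    exact optL (h.mono_one hqr)
  · exact optL ((Lp_isLWP_self hp2).mono_one hpr)
  · have hq2 := hpq.le_two_of_two_le hp2
    have hr'2 : 2 ≤ r' := hr.two_le_of_le_two hr2
    have hr'p : r' ≤ p := by
      have h1 := inv_anti₀ hpq.symm.pos hqr
      rw [← hr.symm.one_sub_inv, ← hpq.one_sub_inv] at h1
      exact (inv_le_inv₀ hp0 hr.symm.pos).1 (by linarith)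
    have hC := wpConst_pos hpq.symm.lt hq2 hr'2
    have hlow := twoPointLower_wpConst hpq.symm hq2 hr'2 hr'p
    have h : IsUWP (Lp 𝕜 (ENNReal.ofReal p) μ) r (wpConst q r' ^ (-(r / r'))) :=
      (Lp_isHanner hp (Or.inl ⟨rfl, hp2⟩)).isUWP hr.lt (hr2.trans hp2)
        (Real.rpow_pos_of_pos hC _) (hlow.upper hpq hr hC)
    refine ⟨h, fun hμ => ⟨h, fun D hD => ?_⟩⟩
    obtain ⟨e₁, e₂, he⟩ := hμ.exists_plane (𝕜 := 𝕜) hp0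
    have hD0 : 0 < D := hD.2.1
    have h1 := ((IsUWP.twoPointUpper hD hp0 he).lower hpq hr hD0).le_wpConst
    have h2 := Real.rpow_le_rpow_of_nonpos (Real.rpow_pos_of_pos hD0 _) h1
      (neg_nonpos.2 (div_pos hr.pos hr.symm.pos).le)
    have e : -(r' / r) * -(r / r') = 1 := by
      have := hr.ne_zero
      have := hr.symm.ne_zero
      field_simp
    rwa [← Real.rpow_mul hD0.le, e, Real.rpow_one] at h2
  · have h : IsUWP (Lp 𝕜 (ENNReal.ofReal p) μ) q 1 := by
      have hq2 := hpq.le_two_of_two_le hp2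
      have hT := (twoPointLower_one hpq.symm hq2).upper hpq hpq.symm one_pos
      rw [Real.one_rpow] at hT
      exact (Lp_isHanner hp (Or.inl ⟨rfl, hp2⟩)).isUWP hpq.symm.lt (hq2.trans hp2) one_pos hT
    exact optU (h.mono_one hr hrq)
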